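/- Setting. Let $n\ge 2$ and let $Ty_n$ be the classical sorted type theory (Gallin's $Ty_n+D$, equivalently Andrews' $Q_0$) with truth type $t$, individual types $e_1,\dots,e_n$, function types $\alpha\beta$ (from $\alpha$ to $\beta$, associated to the right), product types with pairs and projections, and description operators $\iota_{(\alpha t)\alpha}$; write $s=e_n$. Let $\mathcal A=\{a_1,\dots,a_N\}$ be a finite alphabet. $Ty_n^{\mathcal A}$ has, besides arbitrary other non-logical constants, a constant for concatenation $+$ of type $sss$, constants $C^0_s,C^1_s,\dots,C^N_s$, and the axioms $\forall x_s\,(x+C^0=x\wedge C^0+x=x)$, $\forall x_s\forall y_s\forall z_s\,((x+y)+z=x+(y+z))$, and $\forall x_s\forall y_s\forall z_s\,(x+C^i+y\ne x+C^j+z)$ for $1\le i<j\le N$. For a word $w$ over $\mathcal A$ the term $T(w)$ is given by $T(\varepsilon)=C^0_s$, $T(a_i)=C^i_s$, $T(a_iw)=C^i_s+T(w)$ for $w\neq\varepsilon$. Let $Ty_n^{\mathcal A+}$ be an extension of $Ty_n^{\mathcal A}$ by additional constants. $\mathcal T_\alpha$ is the set of $Ty_n^{\mathcal A}$ terms of type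 $\alpha$ (free variables allowed); $\vdash$ is provability in $Ty_n^{\mathcal A}$, and $\Delta\vdash$ is provability from the hypotheses $\Delta$ in $Ty_n^{\mathcal A+}$. Definitions. An $\alpha$-language is a relation $\mathcal L\subseteq\mathcal A^*\times\mathcal T_\alpha$; its range is $\{A\mid (w,A)\in\mathcal L\text{ for some }w\}$. A set $M\subseteq\mathcal T_\alpha$ is logically closed if $B,C\in M$ and $\vdash A=B\vee A=C$ imply $A\in M$. A rule $\mathcal R\subseteq\mathcal T_\alpha\times\mathcal T_\beta$ is logically closed if the image under $\mathcal R$ of every logically closed set is logically closed. For terms $A^1,\dots,A^k$ of type $\alpha$, $\bigvee_{i=1}^k(=A^i)$ denotes $\lambda x_\alpha\,(x=A^1\vee\dots\vee x=A^k)$, with $x$ not free in any $A^i$, and $\lambda x_\alpha\,F$ (with $F$ the false formula) if $k=0$. * A logically closed rule $\mathcal R\subseteq\mathcal T_\alpha\times\mathcal T_\beta$ has the canonic representation $R$ in $D\subseteq\mathcal T_\alpha$, where $R$ is a $Ty_n^{\mathcal A}$ term of type $\alpha\beta t$, if for all $A\in\mathcal T_\alpha$ and $B\in\mathcal T_\beta$: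 $(A,B)\in\mathcal R\iff\ \vdash R\,A\,B$; and for each $A\in D$ there are finitely many (possibly zero) terms $B^1,\dots,B^k\in\mathcal T_\beta$ with $\vdash R\,A=\bigvee_{j=1}^k(=B^j)$. * An $\alpha$-language $\mathcal L$ is represented by $(\Delta,L)$, where $\Delta$ is a consistent set of $Ty_n^{\mathcal A+}$ formulas and $L$ is a $Ty_n^{\mathcal A+}$ term of type $s\alpha t$, if for all $w\in\mathcal A^*$ and $A\in\mathcal T_\alpha$: $(w,A)\in\mathcal L\iff\Delta\vdash L\,T(w)\,A$. * Such a representation is pseudo-canonic if for each word $w$ there are finitely many (possibly zero) terms $A^1,\dots,A^l\in\mathcal T_\alpha$ with $\Delta\vdash L\,T(w)=\bigvee_{i=1}^l(=A^i)$, and if $\Delta$ is conservative over $Ty_n^{\mathcal A}$, i.e. $\vdash A\iff\Delta\vdash A$ for every $Ty_n^{\mathcal A}$ formula $A$. * $\mathcal L\Rightarrow\mathcal R$ is the $\beta$-language $\{(w,B)\mid (w,A)\in\mathcal L\text{ and }(A,B)\in\mathcal R\text{ for some }A\}$. For terms $L$ of type $s\alpha t$ and $R$ of type $\alpha\beta t$,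 the term $L\Rightarrow R$ of type $s\beta t$ is the application to $L$ and $R$ of the operator $\lambda u_{s\alpha t}\,\lambda v_{\alpha\beta t}\,\lambda x_s\,\lambda y_\beta\,\exists z_\alpha\,(u\,x\,z\wedge v\,z\,y)$. Proposition. Let $\alpha,\beta$ be types, let an $\alpha$-language $\mathcal L$ have a pseudo-canonic representation $(\Delta,L)$, and let a logically closed rule $\mathcal R\subseteq\mathcal T_\alpha\times\mathcal T_\beta$ have a canonic representation $R$ in the range of $\mathcal L$. Then the $\beta$-language $\mathcal L\Rightarrow\mathcal R$ is represented by $(\Delta,\,L\Rightarrow R)$, and this representation is again pseudo-canonic. -/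

import Mathlib

universe u v

namespace TyN

/-! ### Types and terms of the sorted type theory `Ty_n` -/

/-- Types of `Ty_n`: the truth type `t`, the individual types `e_1, …, e_n` (indexed by `Fin n`),
functional types (from `a` to `b`) and product types. -/
inductive Ty (n : ℕ) : Type
  | t : Ty n
  | ind (i : Fin n) : Ty n
  | fn (a b : Ty n) : Ty n
  | prod (a b : Ty n) : Ty n

infixr:60 " ⇾ " => Ty.fn

/-- The symbolic type `s`, i.e. the last individual type `e_n`. -/
def Ty.s {n : ℕ} [n.AtLeastTwo] : Ty n :=
  .ind ⟨n - 1, Nat.sub_lt (Nat.lt_of_lt_of_le Nat.zero_lt_two Nat.AtLeastTwo.prop) Nat.one_pos⟩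

/-- `Idx Γ a`: positions (de Bruijn indices) of the type `a` in the list `Γ` of the types of the
variables bound by the surrounding `λ`s. -/
inductive Idx {n : ℕ} : List (Ty n) → Ty n → Type
  | zero {Γ : List (Ty n)} {a : Ty n} : Idx (a :: Γ) a
  | succ {Γ : List (Ty n)} {a b : Ty n} (i : Idx Γ a) : Idx (b :: Γ) a

/-- Terms of `Ty_n` over a family `K` of non-logical constants, up to renaming of bound variables.
`free a k` is the variable `x^k_a` (so there are infinitely many variables of each type); bound
variables are de Bruijn indices into the list `Γ` of the types of the surrounding binders.
The terms of type `a` in the usual sense, with arbitrary free variables, are `Term K [] a`.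
`iota a` is the description operator of type `(a t) a`. -/
inductive Term {n : ℕ} (K : Ty n → Type u) : List (Ty n) → Ty n → Type u
  | free {Γ : List (Ty n)} (a : Ty n) (k : ℕ) : Term K Γ a
  | bound {Γ : List (Ty n)} {a : Ty n} (i : Idx Γ a) : Term K Γ a
  | const {Γ : List (Ty n)} {a : Ty n} (c : K a) : Term K Γ a
  | iota {Γ : List (Ty n)} (a : Ty n) : Term K Γ ((a ⇾ Ty.t) ⇾ a)
  | app {Γ : List (Ty n)} {a b : Ty n} (f : Term K Γ (a ⇾ b)) (x : Term K Γ a) : Term K Γ b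
  | lam {Γ : List (Ty n)} {a b : Ty n} (x : Term K (a :: Γ) b) : Term K Γ (a ⇾ b)
  | eq {Γ : List (Ty n)} {a : Ty n} (x y : Term K Γ a) : Term K Γ Ty.t
  | pair {Γ : List (Ty n)} {a b : Ty n} (x : Term K Γ a) (y : Term K Γ b) : Term K Γ (a.prod b)
  | fst {Γ : List (Ty n)} {a b : Ty n} (x : Term K Γ (a.prod b)) : Term K Γ a
  | snd {Γ : List (Ty n)} {a b : Ty n} (x : Term K Γ (a.prod b)) : Term K Γ b

variable {n : ℕ} {K : Ty n → Type u}

/-- Extension of a renaming of bound variables under one more binder. -/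
def Idx.lift {Γ Γ' : List (Ty n)} (ρ : ∀ a, Idx Γ a → Idx Γ' a) (b : Ty n) :
    ∀ a, Idx (b :: Γ) a → Idx (b :: Γ') a
  | _, .zero => .zero
  | _, .succ i => .succ (ρ _ i)

namespace Term

/-- Renaming of de Bruijn indices. -/
def rename {Γ : List (Ty n)} {a : Ty n} :
    Term K Γ a → ∀ {Γ' : List (Ty n)}, (∀ b, Idx Γ b → Idx Γ' b) → Term K Γ' a
  | free a k, _, _ => free a k
  | bound i, _, ρ => bound (ρ _ i)
  | const c, _, _ => const c
  | iota a, _, _ => iota a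
  | app f x, _, ρ => app (f.rename ρ) (x.rename ρ)
  | lam x, _, ρ => lam (x.rename (Idx.lift ρ _))
  | eq x y, _, ρ => eq (x.rename ρ) (y.rename ρ)
  | pair x y, _, ρ => pair (x.rename ρ) (y.rename ρ)
  | fst x, _, ρ => fst (x.rename ρ)
  | snd x, _, ρ => snd (x.rename ρ)

/-- A term regarded under one more binder (the new bound variable does not occur in it). -/
def wk {Γ : List (Ty n)} {a : Ty n} (b : Ty n) (x : Term K Γ a) : Term K (b :: Γ) a :=
  x.rename (fun _ i => .succ i)

/-- Extension of a substitution for bound variables under one more binder. -/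
def liftSub {Γ Γ' : List (Ty n)} (σ : ∀ a, Idx Γ a → Term K Γ' a) (b : Ty n) :
    ∀ a, Idx (b :: Γ) a → Term K (b :: Γ') a
  | _, .zero => bound .zero
  | _, .succ i => (σ _ i).wk b

/-- Simultaneous (capture-avoiding) substitution for de Bruijn indices. -/
def subst {Γ : List (Ty n)} {a : Ty n} :
    Term K Γ a → ∀ {Γ' : List (Ty n)}, (∀ b, Idx Γ b → Term K Γ' b) → Term K Γ' a
  | free a k, _, _ => free a k
  | bound i, _, σ => σ _ i
  | const c, _, _ => const c
  | iota a, _, _ => iota a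
  | app f x, _, σ => app (f.subst σ) (x.subst σ)
  | lam x, _, σ => lam (x.subst (liftSub σ _))
  | eq x y, _, σ => eq (x.subst σ) (y.subst σ)
  | pair x y, _, σ => pair (x.subst σ) (y.subst σ)
  | fst x, _, σ => fst (x.subst σ)
  | snd x, _, σ => snd (x.subst σ)

/-- The substitution of `y` for the most recently bound variable, identity on the others. -/
def single {Γ : List (Ty n)} {b : Ty n} (y : Term K Γ b) : ∀ a, Idx (b :: Γ) a → Term K Γ a
  | _, .zero => y
  | _, .succ i => bound i

/-- `x.inst y` is the body `x` of an abstraction with `y` put for the abstracted variable. -/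
def inst {Γ : List (Ty n)} {a b : Ty n} (x : Term K (b :: Γ) a) (y : Term K Γ b) : Term K Γ a :=
  x.subst (single y)

/-- Translation of constants, used to regard a term as a term over a larger vocabulary. -/
def mapConst {K' : Ty n → Type v} (f : ∀ a, K a → K' a) {Γ : List (Ty n)} {a : Ty n} :
    Term K Γ a → Term K' Γ a
  | free a k => free a k
  | bound i => bound i
  | const c => const (f _ c)
  | iota a => iota a
  | app g x => app (g.mapConst f) (x.mapConst f)
  | lam x => lam (x.mapConst f)
  | eq x y => eq (x.mapConst f) (y.mapConst f)
  | pair x y => pair (x.mapConst f) (y.mapConst f)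
  | fst x => fst (x.mapConst f)
  | snd x => snd (x.mapConst f)

/-! ### Truth values, connectives and quantifiers, defined from equality as in `Q₀` -/

variable {Γ : List (Ty n)}

/-- Truth, `(λ x_t x) = (λ x_t x)`. -/
def tt : Term K Γ Ty.t := eq (lam (a := Ty.t) (bound .zero)) (lam (bound .zero))

/-- Falsehood, `(λ x_t T) = (λ x_t x)`. -/
def ff : Term K Γ Ty.t := eq (lam (a := Ty.t) tt) (lam (bound .zero))

/-- `∀ x_a A`, that is `(λ x_a T) = (λ x_a A)`. -/
def all {a : Ty n} (A : Term K (a :: Γ) Ty.t) : Term K Γ Ty.t := eq (lam tt) (lam A)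

/-- `¬ A`, that is `F = A`. -/
def neg (A : Term K Γ Ty.t) : Term K Γ Ty.t := eq ff A

/-- `A ∧ B`, that is `(λ g_{ttt} g T T) = (λ g_{ttt} g A B)`. -/
def conj (A B : Term K Γ Ty.t) : Term K Γ Ty.t :=
  eq (lam (a := Ty.t ⇾ Ty.t ⇾ Ty.t) (app (app (bound .zero) tt) tt))
    (lam (app (app (bound .zero) (A.wk _)) (B.wk _)))

/-- `A ∨ B`, that is `¬ (¬ A ∧ ¬ B)`. -/
def disj (A B : Term K Γ Ty.t) : Term K Γ Ty.t := neg (conj (neg A) (neg B))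

/-- `∃ x_a A`, that is `¬ ∀ x_a ¬ A`. -/
def ex {a : Ty n} (A : Term K (a :: Γ) Ty.t) : Term K Γ Ty.t := neg (all (neg A))

/-- The disjunction `(= A₁) ∨ … ∨ (= A_k)` of predicates of type `a t`, that is
`λ x_a (x_a = A₁ ∨ (… ∨ (x_a = A_k ∨ F)))`; for `k = 0` it is `λ x_a F`. -/
def oneOf {a : Ty n} (As : List (Term K Γ a)) : Term K Γ (a ⇾ Ty.t) :=
  lam (As.foldr (fun A φ => disj (eq (bound .zero) (A.wk a)) φ) ff)

end Term

open Term

/-! ### Provability -/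

/-- `Deriv H A`: the formula `A` is provable in `Ty_n` (with description operator and product
types) from the set `H` of hypotheses.  The system has the strength of Andrews' `Q₀`, presented with
hypotheses: equality is a congruence, `β`, `η`, extensionality of the truth type, the two-valuedness
axiom `g T ∧ g F = ∀ x_t g x`, the description axiom `ι (λ x (y = x)) = y`, and pairing. In the
rule `lam` the bound variable must not occur in the hypotheses, so these are weakened; free variables
of the hypotheses are thus never generalized or instantiated. -/
inductive Deriv : {Γ : List (Ty n)} → Set (Term K Γ Ty.t) → Term K Γ Ty.t → Prop
  | hyp {Γ : List (Ty n)} {H : Set (Term K Γ Ty.t)} {A : Term K Γ Ty.t} (h : A ∈ H) : Deriv H A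
  | refl {Γ : List (Ty n)} {H : Set (Term K Γ Ty.t)} {a : Ty n} (x : Term K Γ a) :
      Deriv H (eq x x)
  | symm {Γ : List (Ty n)} {H : Set (Term K Γ Ty.t)} {a : Ty n} {x y : Term K Γ a}
      (h : Deriv H (eq x y)) : Deriv H (eq y x)
  | trans {Γ : List (Ty n)} {H : Set (Term K Γ Ty.t)} {a : Ty n} {x y z : Term K Γ a}
      (h : Deriv H (eq x y)) (h' : Deriv H (eq y z)) : Deriv H (eq x z)
  | app {Γ : List (Ty n)} {H : Set (Term K Γ Ty.t)} {a b : Ty n} {f g : Term K Γ (a ⇾ b)}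
      {x y : Term K Γ a} (h : Deriv H (eq f g)) (h' : Deriv H (eq x y)) :
      Deriv H (eq (app f x) (app g y))
  | lam {Γ : List (Ty n)} {H : Set (Term K Γ Ty.t)} {a b : Ty n} {x y : Term K (a :: Γ) b}
      (h : Deriv (wk a '' H) (eq x y)) : Deriv H (eq (lam x) (lam y))
  | eq {Γ : List (Ty n)} {H : Set (Term K Γ Ty.t)} {a : Ty n} {x y x' y' : Term K Γ a}
      (h : Deriv H (eq x x')) (h' : Deriv H (eq y y')) : Deriv H (eq (eq x y) (eq x' y'))
  | pair {Γ : List (Ty n)} {H : Set (Term K Γ Ty.t)} {a b : Ty n} {x x' : Term K Γ a}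
      {y y' : Term K Γ b} (h : Deriv H (eq x x')) (h' : Deriv H (eq y y')) :
      Deriv H (eq (pair x y) (pair x' y'))
  | fst {Γ : List (Ty n)} {H : Set (Term K Γ Ty.t)} {a b : Ty n} {x y : Term K Γ (a.prod b)}
      (h : Deriv H (eq x y)) : Deriv H (eq (fst x) (fst y))
  | snd {Γ : List (Ty n)} {H : Set (Term K Γ Ty.t)} {a b : Ty n} {x y : Term K Γ (a.prod b)}
      (h : Deriv H (eq x y)) : Deriv H (eq (snd x) (snd y))
  | beta {Γ : List (Ty n)} {H : Set (Term K Γ Ty.t)} {a b : Ty n} (x : Term K (a :: Γ) b)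
      (y : Term K Γ a) : Deriv H (eq (app (lam x) y) (x.inst y))
  | eta {Γ : List (Ty n)} {H : Set (Term K Γ Ty.t)} {a b : Ty n} (f : Term K Γ (a ⇾ b)) :
      Deriv H (eq (lam (app (f.wk a) (bound .zero))) f)
  | fst_pair {Γ : List (Ty n)} {H : Set (Term K Γ Ty.t)} {a b : Ty n} (x : Term K Γ a)
      (y : Term K Γ b) : Deriv H (eq (fst (pair x y)) x)
  | snd_pair {Γ : List (Ty n)} {H : Set (Term K Γ Ty.t)} {a b : Ty n} (x : Term K Γ a)
      (y : Term K Γ b) : Deriv H (eq (snd (pair x y)) y)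
  | pair_eta {Γ : List (Ty n)} {H : Set (Term K Γ Ty.t)} {a b : Ty n} (x : Term K Γ (a.prod b)) :
      Deriv H (eq (pair (fst x) (snd x)) x)
  | eq_mp {Γ : List (Ty n)} {H : Set (Term K Γ Ty.t)} {A B : Term K Γ Ty.t}
      (h : Deriv H (eq A B)) (h' : Deriv H A) : Deriv H B
  | prop_ext {Γ : List (Ty n)} {H : Set (Term K Γ Ty.t)} {A B : Term K Γ Ty.t}
      (h : Deriv (insert A H) B) (h' : Deriv (insert B H) A) : Deriv H (eq A B)
  | bool_cases {Γ : List (Ty n)} {H : Set (Term K Γ Ty.t)} (g : Term K Γ (Ty.t ⇾ Ty.t))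
      (A : Term K Γ Ty.t) (h : Deriv H (app g tt)) (h' : Deriv H (app g ff)) : Deriv H (app g A)
  | iota_eq {Γ : List (Ty n)} {H : Set (Term K Γ Ty.t)} {a : Ty n} (y : Term K Γ a) :
      Deriv H (eq (app (iota a) (lam (eq (y.wk a) (bound .zero)))) y)

/-! ### The symbolic extension `Ty_n^𝒜` for an alphabet with `N` letters -/

/-- Non-logical constants of `Ty_n^𝒜`: the concatenation constant of type `s s s`, the constant for
the empty word, one constant for each of the `N` letters, and arbitrary other constants `C`. -/
inductive SymConst [n.AtLeastTwo] (N : ℕ) (C : Ty n → Type u) : Ty n → Type u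
  | cat : SymConst N C (Ty.s ⇾ Ty.s ⇾ Ty.s)
  | empty : SymConst N C Ty.s
  | letter (i : Fin N) : SymConst N C Ty.s
  | other {a : Ty n} (c : C a) : SymConst N C a

section Symbolic

variable [n.AtLeastTwo] {N : ℕ} {C : Ty n → Type u} {D : Ty n → Type v}

/-- The terms of type `a` of `Ty_n^𝒜` (with arbitrary free variables). -/
abbrev Tm (N : ℕ) (C : Ty n → Type u) (a : Ty n) : Type u := Term (SymConst N C) [] a

/-- Constants of an extension: the constants `C` together with the additional constants `D`. -/
abbrev Plus (C : Ty n → Type u) (D : Ty n → Type v) : Ty n → Type (max u v) :=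
  fun a => C a ⊕ D a

/-- The inclusion of the constants of `Ty_n^𝒜` into those of its extension. -/
def SymConst.emb (D : Ty n → Type v) : ∀ a, SymConst N C a → SymConst N (Plus C D) a
  | _, .cat => .cat
  | _, .empty => .empty
  | _, .letter i => .letter i
  | _, .other c => .other (.inl c)

/-- A term of `Ty_n^𝒜` regarded as a term of its extension by the constants `D`. -/
def emb (D : Ty n → Type v) {a : Ty n} (x : Tm N C a) : Tm N (Plus C D) a :=
  x.mapConst (SymConst.emb D)

/-- The term `x + y` of type `s`. -/
def cat {Γ : List (Ty n)} (x y : Term (SymConst N C) Γ Ty.s) : Term (SymConst N C) Γ Ty.s :=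
  app (app (const .cat) x) y

/-- The term `T_𝒜(w)` that denotes the word `w`. -/
def wordTerm : List (Fin N) → Tm N C Ty.s
  | [] => const .empty
  | [i] => const (.letter i)
  | i :: j :: w => cat (const (.letter i)) (wordTerm (j :: w))

/-- The non-logical axioms of `Ty_n^𝒜`: the empty word is neutral, concatenation is associative, and
`∀ x y z, x + a_i + y ≠ x + a_j + z` for distinct letters `a_i`, `a_j`, `i < j`. -/
inductive SymAxiom : Tm N C Ty.t → Prop
  | neutral : SymAxiom (all (a := Ty.s) (conj
      (eq (cat (bound .zero) (const .empty)) (bound .zero))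
      (eq (cat (const .empty) (bound .zero)) (bound .zero))))
  | assoc : SymAxiom (all (a := Ty.s) (all (a := Ty.s) (all (a := Ty.s)
      (eq (cat (cat (bound (.succ (.succ .zero))) (bound (.succ .zero))) (bound .zero))
        (cat (bound (.succ (.succ .zero))) (cat (bound (.succ .zero)) (bound .zero)))))))
  | letters (i j : Fin N) (h : i < j) :
      SymAxiom (all (a := Ty.s) (all (a := Ty.s) (all (a := Ty.s) (neg
        (eq (cat (cat (bound (.succ (.succ .zero))) (const (.letter i))) (bound (.succ .zero)))
          (cat (cat (bound (.succ (.succ .zero))) (const (.letter j))) (bound .zero)))))))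

/-- `Proves Δ A`: the formula `A` is provable from `Δ` in `Ty_n^𝒜` (in its extension, when the
constants are those of an extension). -/
def Proves (Δ : Set (Tm N C Ty.t)) (A : Tm N C Ty.t) : Prop :=
  Deriv ({B | SymAxiom B} ∪ Δ) A

/-- A set of formulas is consistent if it does not prove `F`. -/
def Consistent (Δ : Set (Tm N C Ty.t)) : Prop := ¬ Proves Δ ff

/-! ### Languages and semantic rules -/

/-- An `a`-language: a relation between words and terms of type `a`. -/
abbrev Language (N : ℕ) (C : Ty n → Type u) (a : Ty n) : Type u := Set (List (Fin N) × Tm N C a)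

/-- A semantic rule: a relation between terms of type `a` and terms of type `b`. -/
abbrev Rule (N : ℕ) (C : Ty n → Type u) (a b : Ty n) : Type u := Set (Tm N C a × Tm N C b)

variable {a b : Ty n}

/-- The set of all meanings that a language can express. -/
def Language.range (𝓛 : Language N C a) : Set (Tm N C a) := {A | ∃ w, (w, A) ∈ 𝓛}

/-- The application of a semantic rule to a language. -/
def Language.applyRule (𝓛 : Language N C a) (𝓡 : Rule N C a b) : Language N C b :=
  {p | ∃ A, (p.1, A) ∈ 𝓛 ∧ (A, p.2) ∈ 𝓡}

/-- A set `M` of terms is logically closed if `A ∈ M` whenever `A = B ∨ A = B'` is provable for some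
`B` and `B'` in `M`. -/
def LogicallyClosed (M : Set (Tm N C a)) : Prop :=
  ∀ A B B', B ∈ M → B' ∈ M → Proves ∅ (disj (eq A B) (eq A B')) → A ∈ M

/-- A rule is logically closed if the full image of every logically closed set is. -/
def Rule.LogicallyClosed (𝓡 : Rule N C a b) : Prop :=
  ∀ M : Set (Tm N C a), TyN.LogicallyClosed M → TyN.LogicallyClosed {B | ∃ A ∈ M, (A, B) ∈ 𝓡}

/-- The logically closed rule `𝓡` has the canonic representation `R` in the set `M` of terms. -/
structure Rule.IsCanonicRep (𝓡 : Rule N C a b) (M : Set (Tm N C a)) (R : Tm N C (a ⇾ b ⇾ Ty.t)) :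
    Prop where
  logicallyClosed : 𝓡.LogicallyClosed
  mem_iff : ∀ A B, (A, B) ∈ 𝓡 ↔ Proves ∅ (app (app R A) B)
  eq_oneOf : ∀ A ∈ M, ∃ Bs : List (Tm N C b), Proves ∅ (eq (app R A) (oneOf Bs))

/-- The language `𝓛` is represented by `(Δ, L)`, where `Δ` is a consistent set of formulas and `L` a
term of an extension of `Ty_n^𝒜` by additional constants `D`. -/
structure Language.IsRepresentedBy (𝓛 : Language N C a) (Δ : Set (Tm N (Plus C D) Ty.t))
    (L : Tm N (Plus C D) (Ty.s ⇾ a ⇾ Ty.t)) : Prop where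
  consistent : Consistent Δ
  mem_iff : ∀ w A, (w, A) ∈ 𝓛 ↔ Proves Δ (app (app L (wordTerm w)) (emb D A))

/-- `(Δ, L)` is a pseudo-canonic representation of the language `𝓛`. -/
structure Language.IsPseudoCanonicRep (𝓛 : Language N C a) (Δ : Set (Tm N (Plus C D) Ty.t))
    (L : Tm N (Plus C D) (Ty.s ⇾ a ⇾ Ty.t)) : Prop where
  represented : 𝓛.IsRepresentedBy Δ L
  eq_oneOf : ∀ w, ∃ As : List (Tm N C a),
    Proves Δ (eq (app L (wordTerm w)) (oneOf (As.map (emb D))))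
  conservative : ∀ A : Tm N C Ty.t, Proves ∅ A ↔ Proves Δ (emb D A)

/-- The semantic rule application operator of type `(s a t) (a b t) s b t`, that is
`λ x_{s a t} λ y_{a b t} λ x_s λ x_b ∃ x_a (x_{s a t} x_s x_a ∧ y_{a b t} x_a x_b)`. -/
def ruleOp (K : Ty n → Type u) (a b : Ty n) :
    Term K [] ((Ty.s ⇾ a ⇾ Ty.t) ⇾ (a ⇾ b ⇾ Ty.t) ⇾ Ty.s ⇾ b ⇾ Ty.t) :=
  lam (lam (lam (lam (ex (a := a) (conj
    (app (app (bound (.succ (.succ (.succ (.succ .zero))))) (bound (.succ (.succ .zero))))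
      (bound .zero))
    (app (app (bound (.succ (.succ (.succ .zero)))) (bound .zero)) (bound (.succ .zero))))))))

/-- The term `L ⇒ R`. -/
def ruleApp {K : Ty n → Type u} (L : Term K [] (Ty.s ⇾ a ⇾ Ty.t))
    (R : Term K [] (a ⇾ b ⇾ Ty.t)) : Term K [] (Ty.s ⇾ b ⇾ Ty.t) :=
  app (app (ruleOp K a b) L) R

end Symbolic

end TyN

/-!
Fix a word `w` and let `Δ ⊢ L T(w) = ⋁ᵢ (= Aᵢ)`. Each `Aᵢ` is then related to `w` by `𝓛`, so that
`R Aᵢ` is provably a finite disjunction `⋁ⱼ (= Bᵢⱼ)`, and `Δ` proves that `(L ⇒ R) T(w)`, which is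
the image of the predicate `L T(w)` under the relation `R`, equals `⋁ᵢⱼ (= Bᵢⱼ)`. Hence
`Δ ⊢ (L ⇒ R) T(w) B` implies `⊢ ⋁ᵢⱼ B = Bᵢⱼ`, by conservativity. The terms `A` with `(w, A) ∈ 𝓛`
form a logically closed set, hence so does its image under `𝓡`, which contains all `Bᵢⱼ`. Logical
closedness, which is about binary disjunctions, extends to finite ones: by means of description,
`A = B₁ ∨ ⋯ ∨ A = Bₖ` yields a term `E` with `E = B₂ ∨ ⋯ ∨ E = Bₖ` and `A = B₁ ∨ A = E`.
-/

namespace TyN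

variable {n : ℕ} {K : Ty n → Type u} {Γ Γ' Γ'' : List (Ty n)} {a b c : Ty n}

/-! ### Substitution -/

namespace Term

theorem rename_rename (x : Term K Γ a) (ρ : ∀ b, Idx Γ b → Idx Γ' b)
    (ρ' : ∀ b, Idx Γ' b → Idx Γ'' b) :
    (x.rename ρ).rename ρ' = x.rename (fun b i => ρ' b (ρ b i)) := by
  induction x generalizing Γ' Γ'' with
  | lam x ih =>
    simp only [rename, ih]
    congr 2
    funext c i
    cases i <;> rfl
  | _ => simp_all only [rename]

theorem subst_rename (x : Term K Γ a) (ρ : ∀ b, Idx Γ b → Idx Γ' b)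
    (σ : ∀ b, Idx Γ' b → Term K Γ'' b) :
    (x.rename ρ).subst σ = x.subst (fun b i => σ b (ρ b i)) := by
  induction x generalizing Γ' Γ'' with
  | lam x ih =>
    simp only [rename, subst, ih]
    congr 2
    funext c i
    cases i <;> rfl
  | _ => simp_all only [rename, subst]

theorem wk_rename (x : Term K Γ a) (ρ : ∀ b, Idx Γ b → Idx Γ' b) :
    (x.wk c).rename (Idx.lift ρ c) = (x.rename ρ).wk c := by
  simp only [wk, rename_rename, Idx.lift]

theorem rename_subst (x : Term K Γ a) (σ : ∀ b, Idx Γ b → Term K Γ' b)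
    (ρ : ∀ b, Idx Γ' b → Idx Γ'' b) :
    (x.subst σ).rename ρ = x.subst (fun b i => (σ b i).rename ρ) := by
  induction x generalizing Γ' Γ'' with
  | lam x ih =>
    simp only [rename, subst, ih]
    congr 2
    funext c i
    cases i with
    | zero => rfl
    | succ i => exact wk_rename _ _
  | _ => simp_all only [rename, subst]

theorem liftSub_bound :
    (liftSub (fun _ i => bound i) a : ∀ c, Idx (a :: Γ) c → Term K (a :: Γ) c) =
      fun _ i => bound i := by
  funext c i
  cases i <;> rfl

theorem subst_bound (x : Term K Γ a) : x.subst (fun _ i => bound i) = x := by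
  induction x with
  | lam x ih => rw [subst, liftSub_bound, ih]
  | _ => simp_all only [subst]

theorem wk_eq_subst (x : Term K Γ a) (c : Ty n) :
    x.wk c = x.subst (fun _ i => bound i.succ) := by
  rw [← subst_bound (x.wk c), wk, subst_rename]

theorem wk_subst (x : Term K Γ a) (σ : ∀ b, Idx Γ b → Term K Γ' b) :
    (x.wk c).subst (liftSub σ c) = (x.subst σ).wk c := by
  simp only [wk, subst_rename, rename_subst, liftSub]

theorem wk_subst_single (x : Term K Γ a) (y : Term K Γ c) : (x.wk c).subst (single y) = x := by
  simp only [wk, subst_rename, single, subst_bound]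

theorem inst_rename (x : Term K (c :: Γ) a) (y : Term K Γ c) (ρ : ∀ b, Idx Γ b → Idx Γ' b) :
    (x.inst y).rename ρ = (x.rename (Idx.lift ρ c)).inst (y.rename ρ) := by
  simp only [inst, rename_subst, subst_rename]
  congr 1
  funext d i
  cases i <;> rfl

section MapConst

variable {K' : Ty n → Type v} (f : ∀ a, K a → K' a)

theorem mapConst_rename (x : Term K Γ a) (ρ : ∀ b, Idx Γ b → Idx Γ' b) :
    (x.rename ρ).mapConst f = (x.mapConst f).rename ρ := by
  induction x generalizing Γ' <;> simp_all only [rename, mapConst]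

theorem mapConst_wk (x : Term K Γ a) (c : Ty n) : (x.wk c).mapConst f = (x.mapConst f).wk c :=
  mapConst_rename f x _

theorem mapConst_subst (x : Term K Γ a) (σ : ∀ b, Idx Γ b → Term K Γ' b) :
    (x.subst σ).mapConst f = (x.mapConst f).subst (fun b i => (σ b i).mapConst f) := by
  induction x generalizing Γ' with
  | lam x ih =>
    simp only [subst, mapConst, ih]
    congr 2
    funext c i
    cases i with
    | zero => rfl
    | succ i => exact mapConst_wk f _ _
  | _ => simp_all only [subst, mapConst]

theorem mapConst_inst (x : Term K (c :: Γ) a) (y : Term K Γ c) :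
    (x.inst y).mapConst f = (x.mapConst f).inst (y.mapConst f) := by
  simp only [inst, mapConst_subst]
  congr 1
  funext d i
  cases i <;> rfl

theorem mapConst_conj (A B : Term K Γ Ty.t) :
    (conj A B).mapConst f = conj (A.mapConst f) (B.mapConst f) := by
  simp only [conj, tt, mapConst, mapConst_wk]

theorem mapConst_disj (A B : Term K Γ Ty.t) :
    (disj A B).mapConst f = disj (A.mapConst f) (B.mapConst f) := by
  simp only [disj, neg, ff, tt, mapConst, mapConst_conj]

theorem mapConst_oneOf (As : List (Term K Γ a)) :
    (oneOf As).mapConst f = oneOf (As.map (mapConst f)) := by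
  simp only [oneOf, mapConst]
  congr 1
  induction As with
  | nil => rfl
  | cons A As ih =>
    simp only [List.foldr_cons, List.map_cons, mapConst_disj, ih, mapConst, mapConst_wk]

end MapConst

/-- Implication, `A = (A ∧ B)` as in `Q₀`. -/
def imp (A B : Term K Γ Ty.t) : Term K Γ Ty.t := eq A (conj A B)

/-- The image `λ y_b ∃ z_a (P z ∧ R z y)` of the predicate `P` under the relation `R`; the predicate
`(L ⇒ R) w` is the image of `L w` under `R`. -/
def image (P : Term K Γ (a ⇾ Ty.t)) (R : Term K Γ (a ⇾ b ⇾ Ty.t)) : Term K Γ (b ⇾ Ty.t) :=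
  lam (ex (conj (app ((P.wk b).wk a) (bound .zero))
    (app (app ((R.wk b).wk a) (bound .zero)) (bound (.succ .zero)))))

/-- The term that denotes `x` if `A` holds and `y` otherwise, defined by the description operator as
the unique `z` with `(A ∧ x = z) ∨ (¬ A ∧ y = z)`. -/
def cond (A : Term K Γ Ty.t) (x y : Term K Γ a) : Term K Γ a :=
  app (iota a) (lam (disj (conj (A.wk a) (eq (x.wk a) (bound .zero)))
    (conj (neg (A.wk a)) (eq (y.wk a) (bound .zero)))))

section Connectives

variable (σ : ∀ b, Idx Γ b → Term K Γ' b)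

theorem conj_subst (A B : Term K Γ Ty.t) :
    (conj A B).subst σ = conj (A.subst σ) (B.subst σ) := by
  simp only [conj, tt, subst, wk_subst, liftSub]

theorem disj_subst (A B : Term K Γ Ty.t) :
    (disj A B).subst σ = disj (A.subst σ) (B.subst σ) := by
  simp only [disj, neg, ff, tt, subst, conj_subst, liftSub]

theorem imp_subst (A B : Term K Γ Ty.t) : (imp A B).subst σ = imp (A.subst σ) (B.subst σ) := by
  simp only [imp, subst, conj_subst]

theorem ex_subst (A : Term K (a :: Γ) Ty.t) : (ex A).subst σ = ex (A.subst (liftSub σ a)) :=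
  rfl

theorem oneOf_subst (As : List (Term K Γ a)) :
    (oneOf As).subst σ = oneOf (As.map (subst · σ)) := by
  simp only [oneOf, subst]
  congr 1
  induction As with
  | nil => rfl
  | cons A As ih =>
    simp only [List.foldr_cons, List.map_cons, disj_subst, ih, subst, wk_subst, liftSub]

theorem oneOf_wk (As : List (Term K Γ a)) (c : Ty n) : (oneOf As).wk c = oneOf (As.map (wk c)) := by
  rw [wk_eq_subst, oneOf_subst]
  simp only [← wk_eq_subst]

theorem image_subst (P : Term K Γ (a ⇾ Ty.t)) (R : Term K Γ (a ⇾ b ⇾ Ty.t)) :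
    (image P R).subst σ = image (P.subst σ) (R.subst σ) := by
  simp only [image, subst, ex_subst, conj_subst, wk_subst, liftSub]
  rfl

theorem image_wk (P : Term K Γ (a ⇾ Ty.t)) (R : Term K Γ (a ⇾ b ⇾ Ty.t)) (c : Ty n) :
    (image P R).wk c = image (P.wk c) (R.wk c) := by
  simp only [wk_eq_subst _ c, image_subst]

end Connectives

end Term

open Term

/-! ### Natural deduction -/

namespace Deriv

variable {H H' : Set (Term K Γ Ty.t)} {A B P Q : Term K Γ Ty.t}

theorem mono (h : Deriv H A) (hH : H ⊆ H') : Deriv H' A := by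
  induction h with
  | hyp h => exact hyp (hH h)
  | refl x => exact refl x
  | symm _ ih => exact symm (ih hH)
  | trans _ _ ih ih' => exact trans (ih hH) (ih' hH)
  | app _ _ ih ih' => exact app (ih hH) (ih' hH)
  | lam _ ih => exact lam (ih (Set.image_mono hH))
  | eq _ _ ih ih' => exact eq (ih hH) (ih' hH)
  | pair _ _ ih ih' => exact pair (ih hH) (ih' hH)
  | fst _ ih => exact fst (ih hH)
  | snd _ ih => exact snd (ih hH)
  | beta x y => exact beta x y
  | eta f => exact eta f
  | fst_pair x y => exact fst_pair x y
  | snd_pair x y => exact snd_pair x y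
  | pair_eta x => exact pair_eta x
  | eq_mp _ _ ih ih' => exact eq_mp (ih hH) (ih' hH)
  | prop_ext _ _ ih ih' =>
    exact prop_ext (ih (Set.insert_subset_insert hH)) (ih' (Set.insert_subset_insert hH))
  | bool_cases g A _ _ ih ih' => exact bool_cases g A (ih hH) (ih' hH)
  | iota_eq y => exact iota_eq y

theorem rename (h : Deriv H A) (ρ : ∀ b, Idx Γ b → Idx Γ' b) :
    Deriv ((fun B => B.rename ρ) '' H) (A.rename ρ) := by
  induction h generalizing Γ' with
  | hyp h => exact hyp (Set.mem_image_of_mem _ h)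
  | refl x => exact refl _
  | symm _ ih => exact symm (ih ρ)
  | trans _ _ ih ih' => exact trans (ih ρ) (ih' ρ)
  | app _ _ ih ih' => exact app (ih ρ) (ih' ρ)
  | lam _ ih =>
    refine lam ((ih (Idx.lift ρ _)).mono ?_)
    rintro _ ⟨_, ⟨B, hB, rfl⟩, rfl⟩
    exact ⟨_, ⟨B, hB, rfl⟩, (wk_rename B ρ).symm⟩
  | eq _ _ ih ih' => exact eq (ih ρ) (ih' ρ)
  | pair _ _ ih ih' => exact pair (ih ρ) (ih' ρ)
  | fst _ ih => exact fst (ih ρ)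
  | snd _ ih => exact snd (ih ρ)
  | beta x y =>
    simp only [Term.rename, inst_rename]
    exact beta _ _
  | eta f =>
    simp only [Term.rename, wk_rename, Idx.lift]
    exact eta _
  | fst_pair x y => exact fst_pair _ _
  | snd_pair x y => exact snd_pair _ _
  | pair_eta x => exact pair_eta _
  | eq_mp _ _ ih ih' => exact eq_mp (ih ρ) (ih' ρ)
  | prop_ext _ _ ih ih' =>
    simp only [Set.image_insert_eq] at ih ih'
    exact prop_ext (ih ρ) (ih' ρ)
  | bool_cases g A _ _ ih ih' => exact bool_cases _ _ (ih ρ) (ih' ρ)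
  | iota_eq y =>
    simp only [Term.rename, wk_rename, Idx.lift]
    exact iota_eq _

theorem mapConst {K' : Ty n → Type v} (h : Deriv H A) (f : ∀ a, K a → K' a) :
    Deriv (Term.mapConst f '' H) (A.mapConst f) := by
  induction h with
  | hyp h => exact hyp (Set.mem_image_of_mem _ h)
  | refl x => exact refl _
  | symm _ ih => exact symm ih
  | trans _ _ ih ih' => exact trans ih ih'
  | app _ _ ih ih' => exact app ih ih'
  | lam _ ih =>
    refine lam (ih.mono ?_)
    rintro _ ⟨_, ⟨B, hB, rfl⟩, rfl⟩
    exact ⟨_, ⟨B, hB, rfl⟩, (mapConst_wk f B _).symm⟩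
  | eq _ _ ih ih' => exact eq ih ih'
  | pair _ _ ih ih' => exact pair ih ih'
  | fst _ ih => exact fst ih
  | snd _ ih => exact snd ih
  | beta x y =>
    simp only [Term.mapConst, mapConst_inst]
    exact beta _ _
  | eta g =>
    simp only [Term.mapConst, mapConst_wk]
    exact eta _
  | fst_pair x y => exact fst_pair _ _
  | snd_pair x y => exact snd_pair _ _
  | pair_eta x => exact pair_eta _
  | eq_mp _ _ ih ih' => exact eq_mp ih ih'
  | prop_ext _ _ ih ih' =>
    rw [Set.image_insert_eq] at ih ih'
    exact prop_ext ih ih'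
  | bool_cases g A _ _ ih ih' => exact bool_cases _ _ ih ih'
  | iota_eq y =>
    simp only [Term.mapConst, mapConst_wk]
    exact iota_eq _

theorem wk (h : Deriv H A) (c : Ty n) : Deriv (Term.wk c '' H) (A.wk c) :=
  h.rename _

theorem weaken (h : Deriv H A) : Deriv (insert B H) A :=
  h.mono (Set.subset_insert _ _)

theorem weaken_insert (h : Deriv (insert A H) P) : Deriv (insert A (insert B H)) P :=
  h.mono (Set.insert_subset_insert (Set.subset_insert _ _))

theorem assumption : Deriv (insert A H) A :=
  hyp (Set.mem_insert _ _)

theorem eq_mp_fun {f g : Term K Γ (a ⇾ Ty.t)} {x : Term K Γ a} (h : Deriv H (.eq f g))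
    (h' : Deriv H (.app f x)) : Deriv H (.app g x) :=
  eq_mp (app h (refl x)) h'

theorem eq_mp_arg {f : Term K Γ (a ⇾ Ty.t)} {x y : Term K Γ a} (h : Deriv H (.eq x y))
    (h' : Deriv H (.app f x)) : Deriv H (.app f y) :=
  eq_mp (app (refl f) h) h'

theorem inst_congr (x : Term K (a :: Γ) b) {y z : Term K Γ a} (h : Deriv H (.eq y z)) :
    Deriv H (.eq (x.inst y) (x.inst z)) :=
  (beta x y).symm.trans ((app (refl _) h).trans (beta x z))

theorem app_lam_congr {x y : Term K (a :: Γ) b} (h : Deriv H (.eq (.lam x) (.lam y)))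
    (z : Term K Γ a) : Deriv H (.eq (x.inst z) (y.inst z)) :=
  (beta x z).symm.trans ((app h (refl z)).trans (beta y z))

theorem pred_ext {f g : Term K Γ (a ⇾ Ty.t)}
    (h : Deriv (insert (.app (f.wk a) (.bound .zero)) (Term.wk a '' H))
      (.app (g.wk a) (.bound .zero)))
    (h' : Deriv (insert (.app (g.wk a) (.bound .zero)) (Term.wk a '' H))
      (.app (f.wk a) (.bound .zero))) :
    Deriv H (.eq f g) :=
  (eta f).symm.trans ((lam (prop_ext h h')).trans (eta g))

theorem truth : Deriv H tt := refl _

theorem eq_tt (h : Deriv H A) : Deriv H (.eq A tt) :=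
  prop_ext truth h.weaken

theorem of_eq_tt (h : Deriv H (.eq A tt)) : Deriv H A :=
  eq_mp h.symm truth

theorem conj_intro (h : Deriv H A) (h' : Deriv H B) : Deriv H (conj A B) :=
  lam (app (app (refl _) (h.eq_tt.symm.wk _)) (h'.eq_tt.symm.wk _))

theorem app_tt_tt_of_conj (h : Deriv H (conj A B)) (f : Term K Γ (Ty.t ⇾ Ty.t ⇾ Ty.t)) :
    Deriv H (.eq (.app (.app f tt) tt) (.app (.app f A) B)) := by
  simpa only [inst, tt, subst, single, liftSub, wk_subst_single] using app_lam_congr h f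

theorem app_fst (A B : Term K Γ Ty.t) :
    Deriv H (.eq (.app (.app (.lam (.lam (.bound (.succ .zero)))) A) B) A) := by
  have hB := beta (H := H) (A.wk Ty.t) B
  rw [inst, wk_subst_single] at hB
  exact (app (beta _ _) (refl _)).trans hB

theorem app_snd (A B : Term K Γ Ty.t) :
    Deriv H (.eq (.app (.app (.lam (.lam (.bound .zero))) A) B) B) :=
  (app (beta _ _) (refl _)).trans (beta _ _)

theorem conj_left (h : Deriv H (conj A B)) : Deriv H A :=
  of_eq_tt ((app_fst A B).symm.trans ((h.app_tt_tt_of_conj _).symm.trans (app_fst _ _)))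

theorem conj_right (h : Deriv H (conj A B)) : Deriv H B :=
  of_eq_tt ((app_snd A B).symm.trans ((h.app_tt_tt_of_conj _).symm.trans (app_snd _ _)))

theorem imp_intro (h : Deriv (insert A H) B) : Deriv H (imp A B) :=
  prop_ext (conj_intro assumption h) assumption.conj_left

theorem imp_elim (h : Deriv H (imp A B)) (h' : Deriv H A) : Deriv H B :=
  (eq_mp h h').conj_right

theorem cut (h : Deriv H A) (h' : Deriv (insert A H) B) : Deriv H B :=
  h'.imp_intro.imp_elim h

theorem ff_elim (h : Deriv H ff) : Deriv H A :=
  of_eq_tt (app_lam_congr h A).symm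

theorem neg_intro (h : Deriv (insert A H) ff) : Deriv H (neg A) :=
  prop_ext assumption.ff_elim h

theorem neg_elim (h : Deriv H (neg A)) (h' : Deriv H A) : Deriv H B :=
  (eq_mp h.symm h').ff_elim

theorem by_cases (A : Term K Γ Ty.t) (h : Deriv (insert A H) B)
    (h' : Deriv (insert (neg A) H) B) : Deriv H B := by
  -- Two-valuedness is applied to the predicate `λ p (A = p → B)`.
  have hbeta (p : Term K Γ Ty.t) :
      Deriv H (.eq (.app (.lam (imp (.eq (A.wk Ty.t) (.bound .zero)) (B.wk Ty.t))) p)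
        (imp (.eq A p) B)) := by
    simpa only [inst, imp_subst, subst, single, wk_subst_single] using
      beta (H := H) (imp (.eq (A.wk Ty.t) (.bound .zero)) (B.wk Ty.t)) p
  have htt : Deriv H (imp (.eq A tt) B) := imp_intro (cut assumption.of_eq_tt h.weaken_insert)
  have hff : Deriv H (imp (.eq A ff) B) := imp_intro (cut assumption.symm h'.weaken_insert)
  have hA : Deriv H (imp (.eq A A) B) :=
    eq_mp (hbeta A) (bool_cases _ A (eq_mp (hbeta tt).symm htt) (eq_mp (hbeta ff).symm hff))
  exact hA.imp_elim (refl A)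

theorem disj_inl (h : Deriv H A) : Deriv H (disj A B) :=
  neg_intro (neg_elim assumption.conj_left h.weaken)

theorem disj_inr (h : Deriv H B) : Deriv H (disj A B) :=
  neg_intro (neg_elim assumption.conj_right h.weaken)

theorem disj_elim (h : Deriv H (disj A B)) (hA : Deriv (insert A H) P)
    (hB : Deriv (insert B H) P) : Deriv H P :=
  by_cases A hA <| by_cases B hB.weaken_insert <|
    neg_elim h.weaken.weaken (conj_intro assumption.weaken assumption)

theorem disj_congr_right (A : Term K Γ Ty.t) (h : Deriv H (.eq P Q)) :
    Deriv H (.eq (disj A P) (disj A Q)) := by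
  simpa only [inst, disj_subst, subst, single, wk_subst_single] using
    inst_congr (disj (A.wk Ty.t) (.bound .zero)) h

theorem all_intro {A : Term K (a :: Γ) Ty.t} (h : Deriv (Term.wk a '' H) A) : Deriv H (all A) :=
  lam h.eq_tt.symm

theorem all_elim {A : Term K (a :: Γ) Ty.t} (h : Deriv H (all A)) (y : Term K Γ a) :
    Deriv H (A.inst y) :=
  of_eq_tt (app_lam_congr h y).symm

theorem ex_intro {A : Term K (a :: Γ) Ty.t} (y : Term K Γ a) (h : Deriv H (A.inst y)) :
    Deriv H (ex A) :=
  neg_intro (neg_elim (A := A.inst y) (all_elim assumption y) h.weaken)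

theorem ex_elim {A : Term K (a :: Γ) Ty.t} (h : Deriv H (ex A))
    (h' : Deriv (insert A (Term.wk a '' H)) (B.wk a)) : Deriv H B := by
  refine by_cases B assumption (neg_elim h.weaken (all_intro (neg_intro ?_)))
  rw [Set.image_insert_eq]
  exact neg_elim (A := B.wk a) assumption.weaken h'.weaken_insert

theorem cond_pos (x y : Term K Γ a) (h : Deriv H A) : Deriv H (.eq (cond A x y) x) := by
  refine trans (app (refl _) (lam (prop_ext ?_ ?_))) (iota_eq x)
  · refine disj_elim assumption assumption.conj_right ?_
    exact neg_elim assumption.conj_left (h.wk a).weaken.weaken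
  · exact disj_inl (conj_intro (h.wk a).weaken assumption)

theorem cond_neg (x y : Term K Γ a) (h : Deriv H (neg A)) : Deriv H (.eq (cond A x y) y) := by
  refine trans (app (refl _) (lam (prop_ext ?_ ?_))) (iota_eq y)
  · refine disj_elim assumption ?_ assumption.conj_right
    exact neg_elim (h.wk a).weaken.weaken assumption.conj_left
  · exact disj_inr (conj_intro (h.wk a).weaken assumption)

theorem app_cond {f : Term K Γ (a ⇾ Ty.t)} {x y : Term K Γ a} (hy : Deriv H (.app f y)) :
    Deriv H (.app f (cond (.app f x) x y)) :=
  by_cases (.app f x) (eq_mp_arg (cond_pos x y assumption).symm assumption)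
    (eq_mp_arg (cond_neg x y assumption).symm hy.weaken)

/-! ### Finite disjunctions and images -/

theorem app_oneOf_nil (x : Term K Γ a) : Deriv H (.eq (.app (oneOf []) x) ff) :=
  beta _ _

theorem app_oneOf_cons (x A : Term K Γ a) (As : List (Term K Γ a)) :
    Deriv H (.eq (.app (oneOf (A :: As)) x) (disj (.eq x A) (.app (oneOf As) x))) := by
  have hcons : Deriv H (.eq (.app (oneOf (A :: As)) x) _) := beta _ x
  have htail : Deriv H (.eq (.app (oneOf As) x) _) := beta _ x
  simp only [inst, List.foldr_cons, disj_subst, subst, single, wk_subst_single] at hcons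
  exact hcons.trans (disj_congr_right _ htail.symm)

theorem oneOf_intro {x A : Term K Γ a} {As : List (Term K Γ a)} (hA : A ∈ As)
    (h : Deriv H (.eq x A)) : Deriv H (.app (oneOf As) x) := by
  induction As with
  | nil => cases hA
  | cons A' As ih =>
    refine eq_mp (app_oneOf_cons x A' As).symm ?_
    rcases List.mem_cons.1 hA with rfl | hA
    · exact disj_inl h
    · exact disj_inr (ih hA)

theorem oneOf_elim {x : Term K Γ a} {As : List (Term K Γ a)} (h : Deriv H (.app (oneOf As) x))
    (h' : ∀ A ∈ As, Deriv (insert (.eq x A) H) P) : Deriv H P := by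
  induction As generalizing H with
  | nil => exact (eq_mp (app_oneOf_nil x) h).ff_elim
  | cons A As ih =>
    obtain ⟨hA, hAs⟩ := List.forall_mem_cons.1 h'
    exact disj_elim (eq_mp (app_oneOf_cons x A As) h) hA
      (ih assumption fun A' hA' => (hAs A' hA').weaken_insert)

theorem oneOf_mono {x : Term K Γ a} {As Bs : List (Term K Γ a)} (hAB : As ⊆ Bs)
    (h : Deriv H (.app (oneOf As) x)) : Deriv H (.app (oneOf Bs) x) :=
  oneOf_elim h fun _ hA => oneOf_intro (hAB hA) assumption

theorem app_image (f : Term K Γ (a ⇾ Ty.t)) (R : Term K Γ (a ⇾ b ⇾ Ty.t)) (y : Term K Γ b) :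
    Deriv H (.eq (.app (image f R) y) (ex (conj (.app (f.wk a) (.bound .zero))
      (.app (.app (R.wk a) (.bound .zero)) (y.wk a))))) := by
  have h : Deriv H (.eq (.app (image f R) y) _) := beta _ y
  simp only [inst, ex_subst, conj_subst, subst, liftSub, single, wk_subst, wk_subst_single] at h
  exact h

theorem image_intro {f : Term K Γ (a ⇾ Ty.t)} {R : Term K Γ (a ⇾ b ⇾ Ty.t)} {x : Term K Γ a}
    {y : Term K Γ b} (hx : Deriv H (.app f x)) (hxy : Deriv H (.app (.app R x) y)) :
    Deriv H (.app (image f R) y) := by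
  refine eq_mp (app_image f R y).symm (ex_intro x ?_)
  simpa only [inst, conj_subst, subst, single, wk_subst_single] using conj_intro hx hxy

theorem image_congr_left {f g : Term K Γ (a ⇾ Ty.t)} (R : Term K Γ (a ⇾ b ⇾ Ty.t))
    (h : Deriv H (.eq f g)) : Deriv H (.eq (image f R) (image g R)) := by
  simpa only [inst, image_subst, subst, single, wk_subst_single] using
    inst_congr (image (.bound .zero) (R.wk _)) h

theorem image_oneOf_elim {As : List (Term K Γ a)} {R : Term K Γ (a ⇾ b ⇾ Ty.t)} {y : Term K Γ b}
    (h : Deriv H (.app (image (oneOf As) R) y))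
    (h' : ∀ A ∈ As, Deriv (insert (.app (.app R A) y) H) P) : Deriv H P := by
  refine ex_elim (eq_mp (app_image _ R y) h) (oneOf_elim (x := .bound .zero)
    (As := As.map (Term.wk a)) ?_ (List.forall_mem_map.2 fun A hA => ?_))
  · rw [← oneOf_wk]
    exact assumption.conj_left
  · refine cut (A := (Term.app (.app R A) y).wk a)
      (eq_mp_fun (app (refl _) assumption) assumption.conj_right.weaken) ?_
    have hA' := (h' A hA).wk a
    rw [Set.image_insert_eq] at hA'
    exact hA'.weaken_insert.weaken_insert

theorem image_oneOf {ι : Type*} {R : Term K Γ (a ⇾ b ⇾ Ty.t)} {l : List ι} {g : ι → Term K Γ a}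
    {f : ι → List (Term K Γ b)} (hR : ∀ i ∈ l, Deriv H (.eq (.app R (g i)) (oneOf (f i)))) :
    Deriv H (.eq (image (oneOf (l.map g)) R) (oneOf (l.flatMap f))) := by
  have hR' (i) (hi : i ∈ l) : Deriv (Term.wk b '' H)
      (.eq (.app (R.wk b) ((g i).wk b)) (oneOf ((f i).map (Term.wk b)))) := by
    rw [← oneOf_wk]
    exact (hR i hi).wk b
  refine pred_ext ?_ ?_ <;> rw [image_wk, oneOf_wk, oneOf_wk, List.map_map]
  · refine image_oneOf_elim assumption (List.forall_mem_map.2 fun i hi => ?_)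
    have hsub : f i ⊆ l.flatMap f := fun B hB => List.mem_flatMap.2 ⟨i, hi, hB⟩
    exact oneOf_mono (List.map_subset _ hsub) (eq_mp_fun (hR' i hi).weaken.weaken assumption)
  · refine oneOf_elim assumption (List.forall_mem_map.2 fun B hB => ?_)
    obtain ⟨i, hi, hB⟩ := List.mem_flatMap.1 hB
    exact image_intro (oneOf_intro (List.mem_map_of_mem hi) (refl _))
      (eq_mp_fun (hR' i hi).symm.weaken.weaken (oneOf_intro (List.mem_map_of_mem hB) assumption))

section RuleApp

variable [n.AtLeastTwo] {H : Set (Term K [] Ty.t)} {L : Term K [] (Ty.s ⇾ a ⇾ Ty.t)}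
  {R : Term K [] (a ⇾ b ⇾ Ty.t)} {w : Term K [] Ty.s}

theorem app_ruleApp (L : Term K [] (Ty.s ⇾ a ⇾ Ty.t)) (R : Term K [] (a ⇾ b ⇾ Ty.t))
    (w : Term K [] Ty.s) : Deriv H (.eq (.app (ruleApp L R) w) (image (.app L w) R)) := by
  have hL : Deriv H (.eq (.app (ruleOp K a b) L) _) := beta _ L
  have hLR : Deriv H (.eq (ruleApp L R) _) := (app hL (refl R)).trans (beta _ R)
  have h := (app hLR (refl w)).trans (beta _ w)
  simp only [inst, ex_subst, conj_subst, subst, liftSub, single, wk_subst, wk_subst_single] at h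
  exact h

theorem ruleApp_intro {x : Term K [] a} {y : Term K [] b} (hx : Deriv H (.app (.app L w) x))
    (hxy : Deriv H (.app (.app R x) y)) : Deriv H (.app (.app (ruleApp L R) w) y) :=
  eq_mp_fun (app_ruleApp L R w).symm (image_intro hx hxy)

theorem ruleApp_oneOf {ι : Type*} {l : List ι} {g : ι → Term K [] a} {f : ι → List (Term K [] b)}
    (hL : Deriv H (.eq (.app L w) (oneOf (l.map g))))
    (hR : ∀ i ∈ l, Deriv H (.eq (.app R (g i)) (oneOf (f i)))) :
    Deriv H (.eq (.app (ruleApp L R) w) (oneOf (l.flatMap f))) :=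
  (app_ruleApp L R w).trans ((image_congr_left R hL).trans (image_oneOf hR))

end RuleApp

end Deriv

/-! ### Languages and rules -/

section Symbolic

open Deriv

variable [n.AtLeastTwo] {N : ℕ} {C : Ty n → Type u} {D : Ty n → Type v}

theorem SymAxiom.emb {A : Tm N C Ty.t} (h : SymAxiom A) : SymAxiom (TyN.emb D A) := by
  cases h with
  | neutral => exact .neutral
  | assoc => exact .assoc
  | letters i j h => exact .letters i j h

theorem Proves.emb {A : Tm N C Ty.t} (h : Proves ∅ A) (Δ : Set (Tm N (Plus C D) Ty.t)) :
    Proves Δ (TyN.emb D A) := by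
  refine (Deriv.mapConst h (SymConst.emb D)).mono ?_
  rintro _ ⟨B, hB | hB, rfl⟩
  · exact Or.inl hB.emb
  · exact hB.elim

theorem emb_disj (A B : Tm N C Ty.t) : emb D (disj A B) = disj (emb D A) (emb D B) :=
  mapConst_disj _ A B

theorem emb_oneOf (As : List (Tm N C a)) : emb D (oneOf As) = oneOf (As.map (emb D)) :=
  mapConst_oneOf _ As

theorem LogicallyClosed.mem_of_oneOf {M : Set (Tm N C a)} (hM : LogicallyClosed M)
    (hcons : Consistent (∅ : Set (Tm N C Ty.t))) {As : List (Tm N C a)} (hAs : ∀ A ∈ As, A ∈ M)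
    {A : Tm N C a} (h : Proves ∅ (app (oneOf As) A)) : A ∈ M := by
  induction As generalizing A with
  | nil => exact absurd (eq_mp (app_oneOf_nil A) h) hcons
  | cons B As ih =>
    obtain ⟨hB, hAs⟩ := List.forall_mem_cons.1 hAs
    have hdisj := eq_mp (app_oneOf_cons A B As) h
    rcases As with _ | ⟨B', As⟩
    · exact hM A B B hB hB (disj_elim hdisj (disj_inl assumption)
        (eq_mp (app_oneOf_nil A) assumption).ff_elim)
    · set E := cond (app (oneOf (B' :: As)) A) A B'
      have hE : E ∈ M := ih hAs (app_cond (oneOf_intro List.mem_cons_self (refl B')))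
      exact hM A B E hB hE (disj_elim hdisj (disj_inl assumption)
        (disj_inr (cond_pos A B' assumption).symm))

theorem logicallyClosed_setOf_proves (Δ : Set (Tm N (Plus C D) Ty.t))
    (f : Tm N (Plus C D) (a ⇾ Ty.t)) :
    LogicallyClosed {A : Tm N C a | Proves Δ (app f (emb D A))} := by
  intro A B B' hB hB' h
  have hdisj := h.emb Δ
  rw [emb_disj] at hdisj
  exact disj_elim hdisj (eq_mp_arg assumption.symm (weaken hB))
    (eq_mp_arg assumption.symm (weaken hB'))

variable {𝓛 : Language N C a} {𝓡 : Rule N C a b} {Δ : Set (Tm N (Plus C D) Ty.t)}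
  {L : Tm N (Plus C D) (Ty.s ⇾ a ⇾ Ty.t)} {R : Tm N C (a ⇾ b ⇾ Ty.t)}

theorem Language.IsRepresentedBy.consistent_empty (hL : 𝓛.IsRepresentedBy Δ L) :
    Consistent (∅ : Set (Tm N C Ty.t)) :=
  fun h => hL.consistent (h.emb Δ)

theorem Language.IsRepresentedBy.logicallyClosed (hL : 𝓛.IsRepresentedBy Δ L)
    (w : List (Fin N)) : LogicallyClosed {A | (w, A) ∈ 𝓛} := by
  simpa only [hL.mem_iff w] using logicallyClosed_setOf_proves Δ (app L (wordTerm w))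

theorem Language.IsRepresentedBy.mem_of_eq_oneOf (hL : 𝓛.IsRepresentedBy Δ L) {w : List (Fin N)}
    {As : List (Tm N C a)} (hAs : Proves Δ (eq (app L (wordTerm w)) (oneOf (As.map (emb D)))))
    {A : Tm N C a} (hA : A ∈ As) : (w, A) ∈ 𝓛 :=
  (hL.mem_iff w A).2 (eq_mp_fun hAs.symm (oneOf_intro (List.mem_map_of_mem hA) (refl _)))

theorem Rule.IsCanonicRep.mem_of_eq_oneOf {M : Set (Tm N C a)} (hR : 𝓡.IsCanonicRep M R)
    {A : Tm N C a} {Bs : List (Tm N C b)} (hBs : Proves ∅ (eq (app R A) (oneOf Bs)))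
    {B : Tm N C b} (hB : B ∈ Bs) : (A, B) ∈ 𝓡 :=
  (hR.mem_iff A B).2 (eq_mp_fun hBs.symm (oneOf_intro hB (refl B)))

theorem Language.IsPseudoCanonicRep.exists_ruleApp_eq_oneOf (hL : 𝓛.IsPseudoCanonicRep Δ L)
    (hR : 𝓡.IsCanonicRep 𝓛.range R) (w : List (Fin N)) :
    ∃ Bs : List (Tm N C b), (∀ B ∈ Bs, (w, B) ∈ 𝓛.applyRule 𝓡) ∧
      Proves Δ (eq (app (ruleApp L (emb D R)) (wordTerm w)) (oneOf (Bs.map (emb D)))) := by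
  obtain ⟨As, hAs⟩ := hL.eq_oneOf w
  have hmem (A) (hA : A ∈ As) : (w, A) ∈ 𝓛 := hL.represented.mem_of_eq_oneOf hAs hA
  choose! f hf using hR.eq_oneOf
  refine ⟨As.flatMap f, fun B hB => ?_, ?_⟩
  · obtain ⟨A, hA, hB⟩ := List.mem_flatMap.1 hB
    exact ⟨A, hmem A hA, hR.mem_of_eq_oneOf (hf A ⟨w, hmem A hA⟩) hB⟩
  · rw [List.map_flatMap]
    refine ruleApp_oneOf hAs fun A hA => ?_
    rw [← emb_oneOf]
    exact (hf A ⟨w, hmem A hA⟩).emb Δ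

theorem Language.IsPseudoCanonicRep.mem_applyRule_of_proves (hL : 𝓛.IsPseudoCanonicRep Δ L)
    (hR : 𝓡.IsCanonicRep 𝓛.range R) {w : List (Fin N)} {B : Tm N C b}
    (h : Proves Δ (app (app (ruleApp L (emb D R)) (wordTerm w)) (emb D B))) :
    (w, B) ∈ 𝓛.applyRule 𝓡 := by
  obtain ⟨Bs, hBs, heq⟩ := hL.exists_ruleApp_eq_oneOf hR w
  have hB : Proves ∅ (app (oneOf Bs) B) := by
    have hB' := eq_mp_fun heq h
    rw [← emb_oneOf] at hB'
    exact (hL.conservative _).2 hB'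
  have hclosed : LogicallyClosed {B | (w, B) ∈ 𝓛.applyRule 𝓡} :=
    hR.logicallyClosed _ (hL.represented.logicallyClosed w)
  exact hclosed.mem_of_oneOf hL.represented.consistent_empty hBs hB

end Symbolic

end TyN

theorem proposition7p8 {n : ℕ} [n.AtLeastTwo] {N : ℕ}
    {C : TyN.Ty n → Type u} {D : TyN.Ty n → Type v} {a b : TyN.Ty n}
    (𝓛 : TyN.Language N C a) (𝓡 : TyN.Rule N C a b)
    (Δ : Set (TyN.Tm N (TyN.Plus C D) TyN.Ty.t))
    (L : TyN.Tm N (TyN.Plus C D) (TyN.Ty.fn TyN.Ty.s (TyN.Ty.fn a TyN.Ty.t)))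
    (R : TyN.Tm N C (TyN.Ty.fn a (TyN.Ty.fn b TyN.Ty.t)))
    (hL : 𝓛.IsPseudoCanonicRep Δ L) (hR : 𝓡.IsCanonicRep 𝓛.range R) :
    (𝓛.applyRule 𝓡).IsRepresentedBy Δ (TyN.ruleApp L (TyN.emb D R)) ∧
      (𝓛.applyRule 𝓡).IsPseudoCanonicRep Δ (TyN.ruleApp L (TyN.emb D R)) := by
  have represented : (𝓛.applyRule 𝓡).IsRepresentedBy Δ (TyN.ruleApp L (TyN.emb D R)) := by
    refine ⟨hL.represented.consistent, fun w B => ⟨?_, hL.mem_applyRule_of_proves hR⟩⟩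
    rintro ⟨A, hA, hAB⟩
    exact .ruleApp_intro ((hL.represented.mem_iff w A).1 hA) (((hR.mem_iff A B).1 hAB).emb Δ)
  refine ⟨represented, represented, fun w => ?_, hL.conservative⟩
  obtain ⟨Bs, -, heq⟩ := hL.exists_ruleApp_eq_oneOf hR w
  exact ⟨Bs, heq⟩
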